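/- **Setting.** For $N\ge 1$ let $\Sigma_N$ be the group of permutations of $\{1,\dots,N\}$. A *virtual permutation* is a sequence $(\sigma_N)_{N\ge1}$ with $\sigma_N\in\Sigma_N$ such that, for every $N \geq 1$, the cycle structure of $\sigma_N$ is obtained from that of $\sigma_{N+1}$ by removing the element $N+1$ from its cycle. Let $\theta>0$. Let $(m_j)_{j\ge1}$ be independent random variables, $m_j\in\{1,\dots,j\}$, with $\mathbb P[m_j=j]=\frac{\theta}{\theta+j-1}$ and $\mathbb P[m_j=k]=\frac{1}{\theta+j-1}$ for $1\le k<j$, and put $\sigma_N=\tau_{N,m_N}\circ\tau_{N-1,m_{N-1}}\circ\dots\circ\tau_{1,m_1}$, where $\tau_{j,k}$ is the permutation exchanging $j$ and $k$ (the identity if $j=k$). Then $(\sigma_N)_{N\ge1}$ is a virtual permutation, and its law is the *Ewens measure* of parameter $\theta$ on virtual permutations. Let $\mathcal L$ be a probability measure on $\mathbb C^*=\mathbb C\setminus\{0\}$. Denote by $\mathbb P(\infty,\theta,\mathcal L)$ the law of the sequence of random matrices $(M(\sigma_N,z_1,\dots,z_N))_{N\ge1}$, where $(\sigma_N)_{N\ge1}$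 follows the Ewens measure of parameter $\theta$ on virtual permutations, $(z_j)_{j\ge1}$ are i.i.d. with law $\mathcal L$ and independent of $(\sigma_N)_{N\ge1}$, and $M(\sigma,z_1,\dots,z_N)$ is the $N\times N$ matrix with entries $M_{jk}=z_j\mathbf 1_{j=\sigma(k)}$. For a complex $N\times N$ matrix $M$ let $\mu(M)=\sum_\lambda m_M(\lambda)\,\delta_\lambda$, the sum running over the eigenvalues $\lambda$ of $M$, where $m_M(\lambda)$ is the multiplicity of $\lambda$ and $\delta_\lambda$ the Dirac measure at $\lambda$; thus $\mu(M)/N$ is a probability measure on $\mathbb C$. **Proposition 3.1.** Let $\theta>0$, let $\mathcal L$ be a probability measure on $\mathbb C^*$, and let $(M_N)_{N\ge1}$ be a sequence of random matrices, defined on a common probability space, with law $\mathbb P(\infty,\theta,\mathcal L)$. Assume that $\log|Z|$ is integrable when $Z$ has law $\mathcal L$. Then, almost surely, as $N\to\infty$, the probability measure $\mu(M_N)/N$ converges weakly to the uniform distribution on the circle of center $0$ and radius $\exp(\mathbb E[\log|Z|])$. -/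

import Mathlib

open MeasureTheory ProbabilityTheory Filter Topology

namespace EwensMatrix

noncomputable section

/-! ### Virtual permutations

The group `Σ_N` is `Equiv.Perm (Fin N)`; the elements `1, …, N` are numbered `0, …, N - 1` here, so
that `Fin.last N` is the element `N + 1` of `{1, …, N + 1}`. -/

/-- The permutation of `N + 1` elements which acts as `σ` on the first `N` ones and fixes the
last one. -/
def addFixedPoint {N : ℕ} (σ : Equiv.Perm (Fin N)) : Equiv.Perm (Fin (N + 1)) :=
  finSuccEquivLast.symm.permCongr σ.optionCongr

/-- The permutation of `N` elements obtained by removing the last element from the cycle of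
`σ` in which it lies: `k` is sent to `σ k`, or to the image of the last element if `σ k` is the
last element. -/
def removeLast {N : ℕ} (σ : Equiv.Perm (Fin (N + 1))) : Equiv.Perm (Fin N) :=
  Equiv.removeNone (finSuccEquivLast.permCongr σ)

/-- A virtual permutation: a sequence of permutations `σ_N ∈ Σ_N` such that the cycle structure of
`σ_N` is obtained from that of `σ_{N+1}` by removing the element `N + 1`. (The level `N = 0` carries
no information: it is the unique permutation of the empty set.) -/
abbrev VirtualPerm : Type :=
  {σ : ∀ N : ℕ, Equiv.Perm (Fin N) // ∀ N, removeLast (σ (N + 1)) = σ N}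

/-- `Φ_N (m_1, …, m_N) = τ_{N, m_N} ∘ ⋯ ∘ τ_{1, m_1}`, where `τ_{j, k}` exchanges `j` and `k`. -/
def permOfCode (m : ∀ j : ℕ, Fin (j + 1)) : ∀ N : ℕ, Equiv.Perm (Fin N)
  | 0 => 1
  | N + 1 => Equiv.swap (Fin.last N) (m N) * addFixedPoint (permOfCode m N)

theorem removeLast_swap_mul_addFixedPoint {N : ℕ} (k : Fin (N + 1)) (σ : Equiv.Perm (Fin N)) :
    removeLast (Equiv.swap (Fin.last N) k * addFixedPoint σ) = σ := by
  have h : finSuccEquivLast.permCongr (Equiv.swap (Fin.last N) k * addFixedPoint σ)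
      = Equiv.swap none (finSuccEquivLast k) * σ.optionCongr := by
    ext1 x
    simp [addFixedPoint, Equiv.permCongr_apply, Equiv.swap_apply_def, Equiv.symm_apply_eq,
      apply_ite (finSuccEquivLast (n := N))]
  rw [removeLast, h]
  exact congrArg Prod.snd (Equiv.Perm.decomposeOption.right_inv (finSuccEquivLast k, σ))

/-- The map `Φ_∞` from sequences `(m_j)`, `m_j ∈ {1, …, j}`, to virtual permutations. -/
def virtualPermOfCode (m : ∀ j : ℕ, Fin (j + 1)) : VirtualPerm :=
  ⟨permOfCode m, fun N => removeLast_swap_mul_addFixedPoint (m N) (permOfCode m N)⟩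

/-! ### The Ewens measure -/

/-- The finite set `Σ_N` carries the discrete σ-algebra; `VirtualPerm` then carries the one
generated by the coordinates. -/
instance instMeasurableSpacePerm (N : ℕ) : MeasurableSpace (Equiv.Perm (Fin N)) := ⊤

instance instDiscretePerm (N : ℕ) : DiscreteMeasurableSpace (Equiv.Perm (Fin N)) := ⟨fun _ => trivial⟩

theorem permOfCode_succ (m : ∀ j : ℕ, Fin (j + 1)) (N : ℕ) : permOfCode m (N + 1) =
    Equiv.swap (Fin.last N) (m N) * addFixedPoint (permOfCode m N) := rfl

theorem measurable_permOfCode (N : ℕ) : Measurable fun m => permOfCode m N := by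
  induction N with
  | zero => exact measurable_const
  | succ N ih =>
    have h : Measurable fun q : Fin (N + 1) × Equiv.Perm (Fin N) =>
      Equiv.swap (Fin.last N) q.1 * addFixedPoint q.2 := Measurable.of_discrete
    have h2 : Measurable fun m : ∀ j : ℕ, Fin (j + 1) => ((m N, permOfCode m N) : Fin (N + 1) × Equiv.Perm (Fin N)) :=
      Measurable.prodMk (measurable_pi_apply N) ih
    have h3 := Measurable.comp h h2
    exact h3

theorem measurable_virtualPermOfCode : Measurable virtualPermOfCode :=
  Measurable.subtype_mk (measurable_pi_lambda _ measurable_permOfCode)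

/-- The law of `m_{j+1} ∈ {1, …, j + 1}`: the value `j + 1` has probability `θ / (θ + j)`, each
smaller value has probability `1 / (θ + j)`. -/
def ewensCodeStep (θ : ℝ) (hθ : 0 < θ) (j : ℕ) : PMF (Fin (j + 1)) :=
  PMF.ofFintype (fun k => ENNReal.ofReal ((if k = Fin.last j then θ else 1) / (θ + j))) (by
    have hpos : (0 : ℝ) < θ + j := by positivity
    rw [← ENNReal.ofReal_sum_of_nonneg
      (fun k _ => div_nonneg (by split_ifs <;> linarith) hpos.le), ← Finset.sum_div,
      Fin.sum_univ_castSucc]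
    simp [Fin.castSucc_ne_last, add_comm (j : ℝ) θ, div_self hpos.ne'])

/-- The Ewens measure of parameter `θ` on virtual permutations: the image by `Φ_∞` of the law of
the sequence of independent variables `m_j` above. -/
def ewensMeasure (θ : ℝ) (hθ : 0 < θ) : Measure VirtualPerm :=
  (Measure.infinitePi fun j => (ewensCodeStep θ hθ j).toMeasure).map virtualPermOfCode

instance instIsProbabilityMeasureEwens (θ : ℝ) (hθ : 0 < θ) : IsProbabilityMeasure (ewensMeasure θ hθ) :=
  Measure.isProbabilityMeasure_map measurable_virtualPermOfCode.aemeasurable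

/-! ### The random matrices -/

/-- Spaces of matrices carry the product (that is, Borel) σ-algebra. -/
instance instMeasurableSpaceMatrix (N : ℕ) : MeasurableSpace (Matrix (Fin N) (Fin N) ℂ) :=
  inferInstanceAs (MeasurableSpace (Fin N → Fin N → ℂ))

/-- The matrix `M(σ, z_1, …, z_N)`, with entries `M_{jk} = z_j 1_{j = σ(k)}`. -/
def genPermMatrix {N : ℕ} (σ : Equiv.Perm (Fin N)) (z : Fin N → ℂˣ) : Matrix (Fin N) (Fin N) ℂ :=
  Matrix.of fun j k => if j = σ k then (z j : ℂ) else 0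

/-- The sequence `(M(σ_N, z_1, …, z_N))_{N ≥ 1}`. -/
def matrixSeq (p : VirtualPerm × (ℕ → ℂˣ)) (N : ℕ+) : Matrix (Fin N) (Fin N) ℂ :=
  genPermMatrix (p.1.1 N) fun j => p.2 j

theorem measurable_matrixSeq : Measurable matrixSeq := by
  have hu : Measurable (Units.val : ℂˣ → ℂ) := comap_measurable _
  refine measurable_pi_lambda _ fun N => measurable_pi_lambda _ fun j =>
    measurable_pi_lambda _ fun k => ?_
  have h1 : Measurable fun p : VirtualPerm × (ℕ → ℂˣ) => p.1.1 (N : ℕ) :=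
    (measurable_pi_apply (N : ℕ)).comp (measurable_subtype_coe.comp measurable_fst)
  have h2 : Measurable fun p : VirtualPerm × (ℕ → ℂˣ) => (p.2 (j : ℕ) : ℂ) :=
    hu.comp ((measurable_pi_apply (j : ℕ)).comp measurable_snd)
  exact Measurable.ite (h1 (MeasurableSet.of_discrete (s := {σ : Equiv.Perm (Fin N) | j = σ k}))) h2 measurable_const

/-- The law `ℙ(∞, θ, 𝓛)` of the sequence `(M(σ_N, z_1, …, z_N))_{N ≥ 1}`, where `(σ_N)` follows the
Ewens measure of parameter `θ` and is independent of the i.i.d. sequence `(z_j)` of law `𝓛`. -/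
def matrixLaw (θ : ℝ) (hθ : 0 < θ) (L : Measure ℂˣ) [IsProbabilityMeasure L] :
    Measure (∀ N : ℕ+, Matrix (Fin N) (Fin N) ℂ) :=
  ((ewensMeasure θ hθ).prod (Measure.infinitePi fun _ : ℕ => L)).map matrixSeq

instance instIsProbabilityMeasureMatrixLaw (θ : ℝ) (hθ : 0 < θ) (L : Measure ℂˣ) [IsProbabilityMeasure L] :
    IsProbabilityMeasure (matrixLaw θ hθ L) :=
  Measure.isProbabilityMeasure_map measurable_matrixSeq.aemeasurable

/-! ### Eigenvalue distributions -/

/-- `μ(M)`: the sum of the Dirac measures at the eigenvalues of `M`, counted with multiplicity. -/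
def eigenvalueMeasure {N : ℕ} (M : Matrix (Fin N) (Fin N) ℂ) : Measure ℂ :=
  (M.charpoly.roots.map Measure.dirac).sum

theorem eigenvalueMeasure_univ {N : ℕ} (M : Matrix (Fin N) (Fin N) ℂ) :
    eigenvalueMeasure M Set.univ = N := by
  have key : ∀ s : Multiset ℂ, (s.map Measure.dirac).sum Set.univ = s.card := by
    intro s
    induction s using Multiset.induction_on with
    | empty => simp
    | cons a s ih => simp [ih, add_comm]
  rw [eigenvalueMeasure, key, IsAlgClosed.card_roots_eq_natDegree, M.charpoly_natDegree_eq_dim,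
    Fintype.card_fin]

/-- The probability measure `μ(M) / N`. -/
def spectralDistribution {N : ℕ} [NeZero N] (M : Matrix (Fin N) (Fin N) ℂ) :
    ProbabilityMeasure ℂ :=
  ⟨(N : ENNReal)⁻¹ • eigenvalueMeasure M, ⟨by
    simpa [eigenvalueMeasure_univ] using
      ENNReal.inv_mul_cancel (Nat.cast_ne_zero.2 (NeZero.ne N)) (ENNReal.natCast_ne_top N)⟩⟩

/-- The uniform distribution on the circle of center `0` and radius `R`: the law of `R e^{i t}` for
`t` uniform on `(0, 2π]`. -/
def uniformCircle (R : ℝ) : ProbabilityMeasure ℂ :=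
  ⟨(volume[|Set.Ioc 0 (2 * Real.pi)]).map (circleMap 0 R), by
    have : IsProbabilityMeasure (volume[|Set.Ioc 0 (2 * Real.pi)]) :=
      cond_isProbabilityMeasure_of_finite (by simp [Real.pi_pos]) measure_Ioc_lt_top.ne
    exact Measure.isProbabilityMeasure_map (continuous_circleMap 0 R).measurable.aemeasurable⟩

end

end EwensMatrix

/-! The code `m` builds the cycles one element at a time: element `N` either opens a cycle (`m N =
Fin.last N`) or is inserted into the cycle of `m N`. A cycle of length `l` whose weights have
product `w` contributes the factor `X ^ l - w` to the characteristic polynomial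
(`charpoly_weightedPermMatrix`), hence `l` equally spaced eigenvalues on the circle of radius `‖w‖ ^
(1 / l)`.

On a long cycle, the law of large numbers applied to `log ‖z_j‖` makes this radius converge to `exp
(E log |Z|)`, and the equal spacing makes the points equidistribute (`abs_sum_nthRoots_sub_le`). A
cycle of bounded length carries mass `O(1 / N)`.

To sum over cycles, it suffices that finitely many of them carry almost all the mass. The proportion
of elements in cycles opened before time `K` is, after normalization by `θ + N`, a bounded
submartingale, so it converges; its limit has mean at least `K / (θ + K)`, which tends to 1
(`ae_forall_exists_card_le`).

These facts concern the code and the weights. They pass to any sequence with the prescribed law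
because the matrices determine the code and the weights measurably
(`measurableEmbedding_matrixSeqOfCode`). -/

namespace EwensMatrix

/-! ### Cycles read off the code -/

/-- The smallest element of the cycle of `j`: follow the code from `j` until it hits an element
which opened its own cycle. -/
def cycleRoot (m : ∀ j : ℕ, Fin (j + 1)) (j : ℕ) : ℕ :=
  if _h : m j = Fin.last j then j else cycleRoot m (m j)
termination_by j
decreasing_by exact Fin.val_lt_last _h

variable {m : ∀ j : ℕ, Fin (j + 1)}

theorem cycleRoot_of_eq_last {j : ℕ} (h : m j = Fin.last j) : cycleRoot m j = j := by
  rw [cycleRoot, dif_pos h]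

theorem cycleRoot_of_ne_last {j : ℕ} (h : m j ≠ Fin.last j) :
    cycleRoot m j = cycleRoot m (m j) := by
  rw [cycleRoot, dif_neg h]

theorem cycleRoot_le (m : ∀ j : ℕ, Fin (j + 1)) (j : ℕ) : cycleRoot m j ≤ j := by
  induction j using Nat.strong_induction_on with
  | _ j ih =>
    by_cases h : m j = Fin.last j
    · rw [cycleRoot_of_eq_last h]
    · rw [cycleRoot_of_ne_last h]
      exact (ih _ (Fin.val_lt_last h)).trans (Fin.val_lt_last h).le

theorem cycleRoot_cycleRoot (m : ∀ j : ℕ, Fin (j + 1)) (j : ℕ) :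
    cycleRoot m (cycleRoot m j) = cycleRoot m j := by
  induction j using Nat.strong_induction_on with
  | _ j ih =>
    by_cases h : m j = Fin.last j
    · rw [cycleRoot_of_eq_last h, cycleRoot_of_eq_last h]
    · rw [cycleRoot_of_ne_last h]
      exact ih _ (Fin.val_lt_last h)

theorem cycleRoot_congr {m m' : ∀ j : ℕ, Fin (j + 1)} {j : ℕ} (h : ∀ i ≤ j, m i = m' i) :
    cycleRoot m j = cycleRoot m' j := by
  induction j using Nat.strong_induction_on with
  | _ j ih =>
    by_cases hj : m j = Fin.last j
    · rw [cycleRoot_of_eq_last hj, cycleRoot_of_eq_last ((h j le_rfl).symm.trans hj)]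
    · have hj' : m' j ≠ Fin.last j := h j le_rfl ▸ hj
      rw [cycleRoot_of_ne_last hj, cycleRoot_of_ne_last hj', ← h j le_rfl]
      exact ih _ (Fin.val_lt_last hj) fun i hi => h i (hi.trans (Fin.val_lt_last hj).le)

/-- The elements below `N` of the cycle of smallest element `k`. -/
def cycleBlock (m : ∀ j : ℕ, Fin (j + 1)) (N k : ℕ) : Finset ℕ :=
  {j ∈ Finset.range N | cycleRoot m j = k}

/-- The smallest elements of the cycles of the permutation of `N` elements coded by `m`. -/
def cycleRoots (m : ∀ j : ℕ, Fin (j + 1)) (N : ℕ) : Finset ℕ :=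
  {k ∈ Finset.range N | cycleRoot m k = k}

theorem mem_cycleBlock {N k j : ℕ} : j ∈ cycleBlock m N k ↔ j < N ∧ cycleRoot m j = k := by
  simp [cycleBlock]

theorem mem_cycleRoots {N k : ℕ} : k ∈ cycleRoots m N ↔ k < N ∧ cycleRoot m k = k := by
  simp [cycleRoots]

theorem cycleBlock_succ (m : ∀ j : ℕ, Fin (j + 1)) (N k : ℕ) : cycleBlock m (N + 1) k =
    if cycleRoot m N = k then insert N (cycleBlock m N k) else cycleBlock m N k := by
  rw [cycleBlock, Finset.range_add_one, Finset.filter_insert]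
  rfl

theorem cycleRoots_succ (m : ∀ j : ℕ, Fin (j + 1)) (N : ℕ) : cycleRoots m (N + 1) =
    if cycleRoot m N = N then insert N (cycleRoots m N) else cycleRoots m N := by
  rw [cycleRoots, Finset.range_add_one, Finset.filter_insert]
  rfl

theorem notMem_cycleBlock (m : ∀ j : ℕ, Fin (j + 1)) (N k : ℕ) : N ∉ cycleBlock m N k := by
  simp [mem_cycleBlock]

theorem cycleRoot_mem_cycleRoots {N j : ℕ} (h : j < N) : cycleRoot m j ∈ cycleRoots m N :=
  mem_cycleRoots.2 ⟨(cycleRoot_le m j).trans_lt h, cycleRoot_cycleRoot m j⟩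

theorem sum_card_cycleBlock (m : ∀ j : ℕ, Fin (j + 1)) (N : ℕ) :
    ∑ k ∈ cycleRoots m N, (cycleBlock m N k).card = N := by
  have h := Finset.card_eq_sum_card_fiberwise (f := cycleRoot m) (s := Finset.range N)
    (t := cycleRoots m N) fun j hj => cycleRoot_mem_cycleRoots (by simpa using hj)
  rw [Finset.card_range] at h
  exact h.symm

/-- Absorbing the weight of `N` into that of `m N` leaves all cycle products unchanged, since both
elements lie in the same cycle. This matches the elimination step in the determinant. -/
theorem prod_update_cycleBlock {R : Type*} [CommRing R] (d : ℕ → R) {N : ℕ}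
    (h : m N ≠ Fin.last N) (k : ℕ) :
    ∏ j ∈ cycleBlock m N k, Function.update d (m N) (d (m N) * d N) j =
      ∏ j ∈ cycleBlock m (N + 1) k, d j := by
  rw [cycleBlock_succ, cycleRoot_of_ne_last h]
  split_ifs with hk
  · have hmem : (m N : ℕ) ∈ cycleBlock m N k := mem_cycleBlock.2 ⟨Fin.val_lt_last h, hk⟩
    rw [Finset.prod_insert (notMem_cycleBlock m N k), Finset.prod_update_of_mem hmem,
      mul_comm (d (m N)), mul_assoc, ← Finset.erase_eq, Finset.mul_prod_erase _ _ hmem]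
  · refine Finset.prod_congr rfl fun j hj => Function.update_of_ne ?_ _ _
    rintro rfl
    exact hk (mem_cycleBlock.1 hj).2

/-! ### Characteristic polynomial and eigenvalues -/

/-- The weighted permutation matrix with entries `d_j 1_{j = σ(k)}`. -/
def weightedPermMatrix {R : Type*} [CommRing R] {N : ℕ} (σ : Equiv.Perm (Fin N)) (d : ℕ → R) :
    Matrix (Fin N) (Fin N) R :=
  Matrix.of fun j k => if j = σ k then d j else 0

theorem permOfCode_succ_castSucc (m : ∀ j : ℕ, Fin (j + 1)) (N : ℕ) (k : Fin N) :
    permOfCode m (N + 1) k.castSucc =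
      if (permOfCode m N k).castSucc = m N then Fin.last N else (permOfCode m N k).castSucc := by
  rw [permOfCode_succ]
  simp [addFixedPoint, Equiv.permCongr_apply, Equiv.swap_apply_def, Fin.castSucc_ne_last]

theorem permOfCode_succ_last (m : ∀ j : ℕ, Fin (j + 1)) (N : ℕ) :
    permOfCode m (N + 1) (Fin.last N) = m N := by
  rw [permOfCode_succ]
  simp [addFixedPoint, Equiv.permCongr_apply]

/-- Induction by eliminating the last index. If it is a fixed point, the matrix is block triangular;
otherwise the Schur complement is the same kind of matrix for `N` elements, with the weight of `m N`
multiplied by `d N`. The weights must therefore vary in the induction. -/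
theorem det_one_sub_weightedPermMatrix {R : Type*} [CommRing R] (m : ∀ j : ℕ, Fin (j + 1))
    (N : ℕ) (d : ℕ → R) :
    (1 - weightedPermMatrix (permOfCode m N) d).det =
      ∏ k ∈ cycleRoots m N, (1 - ∏ j ∈ cycleBlock m N k, d j) := by
  induction N generalizing d with
  | zero => simp [cycleRoots]
  | succ N ih =>
    set B := (1 - weightedPermMatrix (permOfCode m (N + 1)) d).submatrix
      (finSumFinEquiv (m := N) (n := 1)) finSumFinEquiv with hB
    rw [← Matrix.det_submatrix_equiv_self (finSumFinEquiv (m := N) (n := 1)), ← hB,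
      ← B.fromBlocks_toBlocks]
    have hinl : ∀ i : Fin N, finSumFinEquiv (m := N) (n := 1) (Sum.inl i) = i.castSucc :=
      fun i => rfl
    have hinr : ∀ i : Fin 1, finSumFinEquiv (m := N) (n := 1) (Sum.inr i) = Fin.last N :=
      fun i => by ext; simp
    by_cases h : m N = Fin.last N
    · have h12 : B.toBlocks₁₂ = 0 := by
        ext i j
        simp [hB, Matrix.toBlocks₁₂, hinl, hinr, weightedPermMatrix, permOfCode_succ_last, h,
          Fin.castSucc_ne_last]
      have h11 : B.toBlocks₁₁ = 1 - weightedPermMatrix (permOfCode m N) d := by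
        ext i j
        simp [hB, Matrix.toBlocks₁₁, hinl, weightedPermMatrix, permOfCode_succ_castSucc, h,
          Fin.castSucc_ne_last, Matrix.one_apply]
      have h22 : B.toBlocks₂₂.det = 1 - d N := by
        simp [hB, Matrix.toBlocks₂₂, hinr, weightedPermMatrix, permOfCode_succ_last, h]
      have hr := cycleRoot_of_eq_last h
      have hempty : cycleBlock m N N = ∅ := Finset.eq_empty_of_forall_notMem fun j hj => by
        obtain ⟨h1, h2⟩ := mem_cycleBlock.1 hj
        exact absurd (cycleRoot_le m j) (by omega)
      rw [h12, Matrix.det_fromBlocks_zero₁₂, h11, ih, h22, cycleRoots_succ, if_pos hr,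
        Finset.prod_insert (by simp [mem_cycleRoots]), cycleBlock_succ, if_pos hr, hempty, mul_comm]
      congr 1
      · simp
      · refine Finset.prod_congr rfl fun k hk => ?_
        rw [cycleBlock_succ, if_neg]
        rw [hr]
        exact (mem_cycleRoots.1 hk).1.ne'
    · have h22 : B.toBlocks₂₂ = 1 := by
        ext i j
        rw [Subsingleton.elim i j, Matrix.one_apply_eq]
        simp [hB, Matrix.toBlocks₂₂, hinr, weightedPermMatrix, permOfCode_succ_last, Ne.symm h]
      -- The product of the off-diagonal blocks has a single nonzero entry, in row `m N` and in the
      -- column of the preimage of `m N` under the smaller permutation: the two arrows through `N`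
      -- are contracted into one.
      have hkey : B.toBlocks₁₁ - B.toBlocks₁₂ * B.toBlocks₂₁ =
          1 - weightedPermMatrix (permOfCode m N) (Function.update d (m N) (d (m N) * d N)) := by
        ext i j
        have h1 : ∀ i : Fin N, (i.castSucc = m N) ↔ ((i : ℕ) = (m N : ℕ)) := fun i => by
          rw [Fin.ext_iff]; rfl
        have e11 : B.toBlocks₁₁ i j = (if i = j then 1 else 0) -
            if i.castSucc = permOfCode m (N + 1) j.castSucc then d i else 0 := by
          simp [hB, Matrix.toBlocks₁₁, hinl, weightedPermMatrix, Matrix.one_apply]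
        have e12 : B.toBlocks₁₂ i 0 = - if i.castSucc = m N then d i else 0 := by
          simp [hB, Matrix.toBlocks₁₂, hinl, hinr, weightedPermMatrix, permOfCode_succ_last,
            Fin.castSucc_ne_last]
        have e21 : B.toBlocks₂₁ 0 j =
            - if Fin.last N = permOfCode m (N + 1) j.castSucc then d N else 0 := by
          simp [hB, Matrix.toBlocks₂₁, hinl, hinr, weightedPermMatrix,
            (Fin.castSucc_ne_last _).symm]
        have er : (1 - weightedPermMatrix (permOfCode m N)
            (Function.update d (m N) (d (m N) * d N))) i j = (if i = j then 1 else 0) -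
              if i = permOfCode m N j then
                (if i.castSucc = m N then d (m N) * d N else d i) else 0 := by
          simp [weightedPermMatrix, Matrix.one_apply, Function.update_apply, h1]
        rw [er, Matrix.sub_apply, Matrix.mul_apply, Fin.sum_univ_one, e11, e12, e21,
          permOfCode_succ_castSucc]
        by_cases hj : (permOfCode m N j).castSucc = m N
        · have h2 : i = permOfCode m N j ↔ i.castSucc = m N := by
            rw [← hj, Fin.castSucc_inj]
          rw [if_pos hj, if_neg (Fin.castSucc_ne_last i), if_pos rfl]
          by_cases hi : i.castSucc = m N
          · rw [if_pos hi, if_pos (h2.2 hi), if_pos hi, (h1 i).1 hi]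
            ring
          · rw [if_neg hi, if_neg (fun h => hi (h2.1 h))]
            ring
        · rw [if_neg hj, if_neg (Fin.castSucc_ne_last _).symm]
          by_cases hi : i = permOfCode m N j
          · rw [← hi] at hj ⊢
            simp [hj]
          · rw [if_neg hi, if_neg (fun h => hi (Fin.castSucc_injective _ h))]
            ring
      have hr : cycleRoot m N ≠ N := by
        rw [cycleRoot_of_ne_last h]
        exact ((cycleRoot_le m _).trans_lt (Fin.val_lt_last h)).ne
      rw [h22, Matrix.det_fromBlocks_one₂₂, hkey, ih, cycleRoots_succ, if_neg hr]
      simp_rw [prod_update_cycleBlock d h]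

open Polynomial in
theorem charpoly_weightedPermMatrix (m : ∀ j : ℕ, Fin (j + 1)) (N : ℕ) (d : ℕ → ℂ) :
    (weightedPermMatrix (permOfCode m N) d).charpoly =
      ∏ k ∈ cycleRoots m N, (X ^ (cycleBlock m N k).card - C (∏ j ∈ cycleBlock m N k, d j)) := by
  -- Off `x = 0`, the matrix `x - W` equals `x • (1 - x⁻¹ W)`, so the determinant identity applies
  -- with weights `x⁻¹ * d j`.
  refine eq_of_infinite_eval_eq _ _ (((Set.finite_singleton (0 : ℂ)).infinite_compl).mono ?_)
  intro x hx
  have hx : x ≠ 0 := hx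
  have h1 : (Matrix.scalar (Fin N)) x - weightedPermMatrix (permOfCode m N) d =
      x • (1 - weightedPermMatrix (permOfCode m N) (fun j => x⁻¹ * d j)) := by
    ext i j
    simp only [weightedPermMatrix, Matrix.scalar_apply, Matrix.sub_apply, Matrix.diagonal_apply,
      Matrix.of_apply, Matrix.smul_apply, Matrix.one_apply, smul_eq_mul]
    split_ifs <;> simp [mul_sub, hx]
  change eval x _ = eval x _
  rw [Matrix.eval_charpoly, h1, Matrix.det_smul, det_one_sub_weightedPermMatrix, eval_prod,
    Fintype.card_fin]
  -- The factor `x ^ N` is shared among the cycles according to their lengths.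
  nth_rewrite 1 [← sum_card_cycleBlock m N]
  rw [← Finset.prod_pow_eq_pow_sum, ← Finset.prod_mul_distrib]
  refine Finset.prod_congr rfl fun k _ => ?_
  rw [Finset.prod_mul_distrib, Finset.prod_const]
  simp [mul_sub, hx, eval_prod]

open Polynomial in
theorem roots_charpoly_weightedPermMatrix (m : ∀ j : ℕ, Fin (j + 1)) (N : ℕ) (d : ℕ → ℂ) :
    (weightedPermMatrix (permOfCode m N) d).charpoly.roots =
      ∑ k ∈ cycleRoots m N,
        nthRoots (cycleBlock m N k).card (∏ j ∈ cycleBlock m N k, d j) := by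
  have h0 := (Matrix.charpoly_monic (weightedPermMatrix (permOfCode m N) d)).ne_zero
  rw [charpoly_weightedPermMatrix] at h0 ⊢
  rw [roots_prod _ _ h0]
  rfl

/-! ### Test functions against eigenvalues and the uniform law on a circle -/

theorem integrable_multiset_sum_dirac (s : Multiset ℂ) (f : ℂ → ℝ) :
    Integrable f (s.map Measure.dirac).sum := by
  induction s using Multiset.induction_on with
  | empty => simp
  | cons a s ih =>
    rw [Multiset.map_cons, Multiset.sum_cons]
    exact (integrable_dirac (by simp)).add_measure ih

theorem integral_multiset_sum_dirac (s : Multiset ℂ) (f : ℂ → ℝ) :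
    ∫ x, f x ∂(s.map Measure.dirac).sum = (s.map f).sum := by
  induction s using Multiset.induction_on with
  | empty => simp
  | cons a s ih =>
    rw [Multiset.map_cons, Multiset.sum_cons, integral_add_measure (integrable_dirac (by simp))
      (integrable_multiset_sum_dirac s f), ih, integral_dirac]
    simp

open Polynomial in
theorem integral_eigenvalueMeasure_weightedPermMatrix (m : ∀ j : ℕ, Fin (j + 1)) (N : ℕ)
    (d : ℕ → ℂ) (f : ℂ → ℝ) :
    ∫ x, f x ∂eigenvalueMeasure (weightedPermMatrix (permOfCode m N) d) =
      ∑ k ∈ cycleRoots m N,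
        ((nthRoots (cycleBlock m N k).card (∏ j ∈ cycleBlock m N k, d j)).map f).sum := by
  rw [eigenvalueMeasure, integral_multiset_sum_dirac, roots_charpoly_weightedPermMatrix,
    ← Multiset.coe_mapAddMonoidHom, map_sum, ← Multiset.coe_sumAddMonoidHom, map_sum]

theorem integral_uniformCircle (R : ℝ) {f : ℂ → ℝ} (hf : Continuous f) :
    ∫ x, f x ∂(uniformCircle R : Measure ℂ) =
      (2 * Real.pi)⁻¹ * ∫ t in (0)..(2 * Real.pi), f (circleMap 0 R t) := by
  change ∫ x, f x ∂((volume[|Set.Ioc 0 (2 * Real.pi)]).map (circleMap 0 R)) = _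
  rw [integral_map (continuous_circleMap 0 R).measurable.aemeasurable hf.aestronglyMeasurable,
    ProbabilityTheory.cond, integral_smul_measure, Real.volume_Ioc, sub_zero,
    intervalIntegral.integral_of_le Real.two_pi_pos.le, ENNReal.toReal_inv,
    ENNReal.toReal_ofReal Real.two_pi_pos.le, smul_eq_mul]

/-- Listing the roots by increasing angle makes the arcs between consecutive ones tile one full
turn. -/
theorem nthRoots_eq_map_circleMap {l : ℕ} (hl : 0 < l) (w : ℂ) :
    Polynomial.nthRoots l w = (Multiset.range l).map fun i : ℕ =>
      circleMap 0 (‖w‖ ^ (l : ℝ)⁻¹) (w.arg / l + i * (2 * Real.pi / l)) := by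
  have hl' : (l : ℂ) ≠ 0 := by exact_mod_cast hl.ne'
  have hpow : (circleMap 0 (‖w‖ ^ (l : ℝ)⁻¹) (w.arg / l)) ^ l = w := by
    have h1 : (‖w‖ ^ (l : ℝ)⁻¹) ^ l = ‖w‖ := Real.rpow_inv_natCast_pow (norm_nonneg w) hl.ne'
    rw [circleMap_zero, mul_pow, ← Complex.exp_nat_mul, ← Complex.ofReal_pow, h1]
    push_cast
    rw [← mul_assoc, mul_div_cancel₀ _ hl']
    exact Complex.norm_mul_exp_arg_mul_I w
  rw [(Complex.isPrimitiveRoot_exp l hl.ne').nthRoots_eq hpow]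
  refine Multiset.map_congr rfl fun i _ => ?_
  rw [circleMap_zero, circleMap_zero, mul_left_comm, ← Complex.exp_nat_mul, ← Complex.exp_add]
  congr 2
  push_cast
  ring

theorem dist_circleMap_le {R : ℝ} (hR : 0 ≤ R) (r s t : ℝ) :
    dist (circleMap 0 r s) (circleMap 0 R t) ≤ |r - R| + R * |s - t| := by
  refine (dist_triangle _ (circleMap 0 R s) _).trans (add_le_add ?_ ?_)
  · rw [circleMap_zero, circleMap_zero, dist_eq_norm, ← sub_mul, norm_mul,
      Complex.norm_exp_ofReal_mul_I, mul_one, ← Complex.ofReal_sub, Complex.norm_real,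
      Real.norm_eq_abs]
  · have h := (lipschitzWith_circleMap 0 R).dist_le_mul s t
    rwa [Real.coe_nnabs, abs_of_nonneg hR, Real.dist_eq] at h

/-- Each root is compared with the mean of `f` on the arc of radius `R` from its angle to the next
one: the distance is at most the radial gap plus the arc length. -/
theorem abs_sum_nthRoots_sub_le {R : ℝ} (hR : 0 ≤ R) {f : ℂ → ℝ} {L : NNReal}
    (hf : LipschitzWith L f) {l : ℕ} (hl : 0 < l) (w : ℂ) :
    |((Polynomial.nthRoots l w).map f).sum - l * ∫ x, f x ∂(uniformCircle R : Measure ℂ)| ≤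
      l * (L * (|‖w‖ ^ (l : ℝ)⁻¹ - R| + R * (2 * Real.pi / l))) := by
  set r := ‖w‖ ^ (l : ℝ)⁻¹
  set t : ℕ → ℝ := fun i => w.arg / l + i * (2 * Real.pi / l) with ht
  have hl' : (0 : ℝ) < l := by exact_mod_cast hl
  have hstep : ∀ i, t (i + 1) - t i = 2 * Real.pi / l := fun i => by
    simp only [ht]; push_cast; ring
  have hpos : 0 < 2 * Real.pi / l := by positivity
  have hcont : Continuous fun s => f (circleMap 0 R s) :=
    hf.continuous.comp (continuous_circleMap 0 R)
  have hint : ∫ s in (0)..(2 * Real.pi), f (circleMap 0 R s) =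
      ∑ i ∈ Finset.range l, ∫ s in (t i)..(t (i + 1)), f (circleMap 0 R s) := by
    rw [intervalIntegral.sum_integral_adjacent_intervals
      (fun i _ => hcont.intervalIntegrable _ _)]
    -- The arcs start at `w.arg / l` rather than 0; periodicity removes the offset.
    have hper : Function.Periodic (fun s => f (circleMap 0 R s)) (2 * Real.pi) := fun s => by
      simp only [periodic_circleMap 0 R s]
    have h := hper.intervalIntegral_add_eq 0 (t 0)
    rw [zero_add] at h
    rw [h]
    congr 1
    simp only [ht]
    field_simp
    push_cast
    ring
  rw [nthRoots_eq_map_circleMap hl, Multiset.map_map, integral_uniformCircle R hf.continuous, hint,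
    Finset.mul_sum, Finset.mul_sum]
  change |∑ i ∈ Finset.range l, f (circleMap 0 r (t i)) - _| ≤ _
  rw [← Finset.sum_sub_distrib]
  refine (Finset.abs_sum_le_sum_abs _ _).trans ?_
  refine (Finset.sum_le_card_nsmul _ _ (L * (|r - R| + R * (2 * Real.pi / l))) fun i _ => ?_).trans
    (by rw [Finset.card_range, nsmul_eq_mul])
  have h1 : f (circleMap 0 r (t i)) - l * ((2 * Real.pi)⁻¹ *
      ∫ s in (t i)..(t (i + 1)), f (circleMap 0 R s)) =
      (l / (2 * Real.pi)) * ∫ s in (t i)..(t (i + 1)),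
        (f (circleMap 0 r (t i)) - f (circleMap 0 R s)) := by
    rw [intervalIntegral.integral_sub (by simp) (hcont.intervalIntegrable _ _),
      intervalIntegral.integral_const, hstep, smul_eq_mul]
    field_simp
  rw [h1, abs_mul, abs_of_pos (by positivity)]
  have h2 := intervalIntegral.norm_integral_le_of_norm_le_const (a := t i) (b := t (i + 1))
    (f := fun s => f (circleMap 0 r (t i)) - f (circleMap 0 R s))
    (C := L * (|r - R| + R * (2 * Real.pi / l))) (fun s hs => by
      rw [Set.uIoc_of_le (by linarith [hstep i])] at hs
      rw [← dist_eq_norm]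
      refine (hf.dist_le_mul _ _).trans (mul_le_mul_of_nonneg_left ?_ L.2)
      refine (dist_circleMap_le hR _ _ _).trans ?_
      gcongr
      rw [abs_le]
      constructor <;> linarith [hstep i, hs.1, hs.2])
  rw [hstep, abs_of_pos hpos, Real.norm_eq_abs] at h2
  calc _ ≤ l / (2 * Real.pi) * (L * (|r - R| + R * (2 * Real.pi / l)) * (2 * Real.pi / l)) := by
        gcongr
    _ = _ := by field_simp

/-- A bound by oscillation alone, for cycles where equidistribution is unavailable. -/
theorem abs_sub_integral_le {μ : Measure ℂ} [IsProbabilityMeasure μ] {f : ℂ → ℝ}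
    (hf : Continuous f) {C : ℝ} (hC : ∀ x y, dist (f x) (f y) ≤ C) (x : ℂ) :
    |f x - ∫ y, f y ∂μ| ≤ C := by
  have hint : Integrable f μ := by
    refine Integrable.of_bound hf.aestronglyMeasurable (C + ‖f 0‖) (ae_of_all _ fun y => ?_)
    have := norm_sub_norm_le (f y) (f 0)
    have := hC y 0
    rw [dist_eq_norm] at this
    linarith
  have h : f x - ∫ y, f y ∂μ = ∫ y, (f x - f y) ∂μ := by
    rw [integral_sub (integrable_const _) hint]
    simp
  rw [h, ← Real.norm_eq_abs]
  refine (norm_integral_le_of_norm_le_const (C := C) (ae_of_all _ fun y => ?_)).trans (by simp)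
  rw [← dist_eq_norm]
  exact hC x y

theorem abs_sum_map_sub_card_mul_le (s : Multiset ℂ) (f : ℂ → ℝ) (a C : ℝ)
    (h : ∀ x, |f x - a| ≤ C) : |(s.map f).sum - s.card * a| ≤ C * s.card := by
  induction s using Multiset.induction_on with
  | empty => simp
  | cons x s ih =>
    simp only [Multiset.map_cons, Multiset.sum_cons, Multiset.card_cons]
    push_cast
    calc _ = |(f x - a) + ((s.map f).sum - s.card * a)| := by ring_nf
      _ ≤ _ := abs_add_le _ _
      _ ≤ _ := by linarith [h x]

theorem card_nthRoots_complex (l : ℕ) (w : ℂ) : (Polynomial.nthRoots l w).card = l := by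
  rcases Nat.eq_zero_or_pos l with rfl | hl
  · simp
  · simp [nthRoots_eq_map_circleMap hl]

/-! ### From single cycles to the whole spectrum -/

theorem cycleBlock_mono (m : ∀ j : ℕ, Fin (j + 1)) (k : ℕ) :
    Monotone fun N => cycleBlock m N k := fun _ _ h =>
  Finset.filter_subset_filter _ (Finset.range_subset_range.2 h)

theorem card_cycleBlock_le (m : ∀ j : ℕ, Fin (j + 1)) (N k : ℕ) : (cycleBlock m N k).card ≤ N :=
  (Finset.card_filter_le _ _).trans (Finset.card_range N).le

theorem sum_card_cycleBlock_of_le (m : ∀ j : ℕ, Fin (j + 1)) (N K : ℕ) :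
    ∑ k ∈ cycleRoots m N with K ≤ k, (cycleBlock m N k).card =
      (Finset.card {j ∈ Finset.range N | K ≤ cycleRoot m j}) := by
  have h := Finset.card_eq_sum_card_fiberwise (f := cycleRoot m)
    (s := {j ∈ Finset.range N | K ≤ cycleRoot m j}) (t := {k ∈ cycleRoots m N | K ≤ k})
    fun j hj => by
      have hj := Finset.mem_filter.1 (Finset.mem_coe.1 hj)
      exact Finset.mem_coe.2 (Finset.mem_filter.2
        ⟨cycleRoot_mem_cycleRoots (Finset.mem_range.1 hj.1), hj.2⟩)
  rw [h]
  refine Finset.sum_congr rfl fun k hk => ?_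
  congr 1
  ext j
  have := (Finset.mem_filter.1 hk).2
  simp only [mem_cycleBlock, Finset.mem_filter, Finset.mem_range]
  constructor
  · rintro ⟨h1, rfl⟩; exact ⟨⟨h1, this⟩, rfl⟩
  · rintro ⟨⟨h1, _⟩, h2⟩; exact ⟨h1, h2⟩

theorem norm_prod_rpow_inv_card {s : Finset ℕ} {d : ℕ → ℂ} (hd : ∀ j, d j ≠ 0) :
    ‖∏ j ∈ s, d j‖ ^ (s.card : ℝ)⁻¹ = Real.exp ((∑ j ∈ s, Real.log ‖d j‖) / s.card) := by
  rw [norm_prod, ← Real.log_prod (fun j _ => norm_ne_zero_iff.2 (hd j)),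
    Real.rpow_def_of_pos (Finset.prod_pos fun j _ => norm_pos_iff.2 (hd j)), div_eq_mul_inv]

/-- The contribution of one cycle to the error in the approximation by the uniform law. -/
theorem tendsto_cycle_error {d : ℕ → ℂ} (hd : ∀ j, d j ≠ 0) {c : ℝ} {k : ℕ}
    (hlog : Tendsto (fun N => (cycleBlock m N k).card) atTop atTop →
      Tendsto (fun N => (∑ j ∈ cycleBlock m N k, Real.log ‖d j‖) / (cycleBlock m N k).card) atTop
        (𝓝 c))
    {f : ℂ → ℝ} {C : ℝ} (hC : ∀ x y, dist (f x) (f y) ≤ C) {L : NNReal} (hf : LipschitzWith L f) :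
    Tendsto (fun N : ℕ => |((Polynomial.nthRoots (cycleBlock m N k).card
      (∏ j ∈ cycleBlock m N k, d j)).map f).sum -
        (cycleBlock m N k).card * ∫ x, f x ∂(uniformCircle (Real.exp c) : Measure ℂ)| / N)
      atTop (𝓝 0) := by
  -- The length is nondecreasing in `N`: either it diverges, and equidistribution applies, or it is
  -- eventually a constant `b`, and the error is at most `C * b / N`.
  rcases tendsto_atTop_of_monotone (fun _ _ h => Finset.card_le_card (cycleBlock_mono m k h) :
    Monotone fun N => (cycleBlock m N k).card) with htop | ⟨b, hb⟩
  · have hlim : Tendsto (fun N => (L : ℝ) *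
        (|Real.exp ((∑ j ∈ cycleBlock m N k, Real.log ‖d j‖) / (cycleBlock m N k).card) -
          Real.exp c| + Real.exp c * (2 * Real.pi / (cycleBlock m N k).card))) atTop (𝓝 0) := by
      have h1 := (((Real.continuous_exp.tendsto c).comp (hlog htop)).sub_const (Real.exp c)).abs
      have h2 : Tendsto (fun N => 2 * Real.pi / ((cycleBlock m N k).card : ℝ)) atTop (𝓝 0) :=
        tendsto_const_nhds.div_atTop (tendsto_natCast_atTop_atTop.comp htop)
      simpa using (h1.add (h2.const_mul (Real.exp c))).const_mul (L : ℝ)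
    refine squeeze_zero' (Eventually.of_forall fun N => by positivity) ?_ hlim
    filter_upwards [htop.eventually_gt_atTop 0] with N hN
    have h := abs_sum_nthRoots_sub_le (Real.exp_pos c).le hf hN (∏ j ∈ cycleBlock m N k, d j)
    rw [norm_prod_rpow_inv_card hd] at h
    have hNpos : (0 : ℝ) < N := by exact_mod_cast hN.trans_le (card_cycleBlock_le m N k)
    rw [div_le_iff₀ hNpos, mul_comm _ (N : ℝ)]
    refine h.trans (mul_le_mul_of_nonneg_right ?_ (by positivity))
    exact_mod_cast card_cycleBlock_le m N k
  · have hlim : Tendsto (fun N : ℕ => C * b / (N : ℝ)) atTop (𝓝 0) :=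
      tendsto_const_nhds.div_atTop tendsto_natCast_atTop_atTop
    refine squeeze_zero' (Eventually.of_forall fun N => by positivity) ?_ hlim
    filter_upwards [hb.eventually (show {b} ∈ 𝓝 b by simp)] with N hN
    gcongr
    have h := abs_sum_map_sub_card_mul_le (Polynomial.nthRoots (cycleBlock m N k).card
      (∏ j ∈ cycleBlock m N k, d j)) f _ C
        (abs_sub_integral_le (μ := (uniformCircle (Real.exp c) : Measure ℂ)) hf.continuous hC)
    rw [card_nthRoots_complex] at h
    have hN : (cycleBlock m N k).card = b := hN
    rwa [hN] at h ⊢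

/-- Cycles with root below `K` are finitely many, and each has vanishing error; the others are
bounded by oscillation times their total mass, small by tightness. -/
theorem tendsto_average_eigenvalues {d : ℕ → ℂ} (hd : ∀ j, d j ≠ 0) {c : ℝ}
    (htight : ∀ ε > (0 : ℝ), ∃ K : ℕ, ∀ᶠ N : ℕ in atTop,
      ((Finset.card {j ∈ Finset.range N | K ≤ cycleRoot m j} : ℕ) : ℝ) ≤ ε * N)
    (hlog : ∀ k, Tendsto (fun N => (cycleBlock m N k).card) atTop atTop →
      Tendsto (fun N => (∑ j ∈ cycleBlock m N k, Real.log ‖d j‖) / (cycleBlock m N k).card) atTop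
        (𝓝 c))
    {f : ℂ → ℝ} {C : ℝ} (hC : ∀ x y, dist (f x) (f y) ≤ C) {L : NNReal} (hf : LipschitzWith L f) :
    Tendsto (fun N : ℕ => (N : ℝ)⁻¹ *
      ∫ x, f x ∂eigenvalueMeasure (weightedPermMatrix (permOfCode m N) d)) atTop
        (𝓝 (∫ x, f x ∂(uniformCircle (Real.exp c) : Measure ℂ))) := by
  set I := ∫ x, f x ∂(uniformCircle (Real.exp c) : Measure ℂ) with hI
  set S : ℕ → ℕ → ℝ := fun N k => ((Polynomial.nthRoots (cycleBlock m N k).card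
      (∏ j ∈ cycleBlock m N k, d j)).map f).sum with hS
  have hC0 : 0 ≤ C := by simpa using hC 0 0
  rw [Metric.tendsto_atTop']
  intro ε hε
  -- `C + 1` instead of `C` avoids dividing by zero when `f` is constant.
  obtain ⟨K, hK⟩ := htight (ε / (2 * (C + 1))) (by positivity)
  have hsmall : Tendsto (fun N : ℕ => ∑ k ∈ Finset.range K,
      |S N k - (cycleBlock m N k).card * I| / N) atTop (𝓝 0) := by
    simpa using tendsto_finsetSum (Finset.range K)
      fun k _ => tendsto_cycle_error hd (hlog k) hC hf
  obtain ⟨N₀, hN₀⟩ := eventually_atTop.1 (hK.and ((hsmall.eventually_lt_const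
    (show (0 : ℝ) < ε / 2 by positivity)).and (eventually_gt_atTop 0)))
  refine ⟨N₀, fun N hN => ?_⟩
  obtain ⟨h1, h2, h3⟩ := hN₀ N hN.le
  have hNpos : (0 : ℝ) < N := by exact_mod_cast h3
  have hbound : ∀ k, |S N k - (cycleBlock m N k).card * I| ≤ C * (cycleBlock m N k).card := by
    intro k
    have h := abs_sum_map_sub_card_mul_le (Polynomial.nthRoots (cycleBlock m N k).card
      (∏ j ∈ cycleBlock m N k, d j)) f _ C
        (abs_sub_integral_le (μ := (uniformCircle (Real.exp c) : Measure ℂ)) hf.continuous hC)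
    rwa [card_nthRoots_complex] at h
  have hdiff : (N : ℝ)⁻¹ * ∫ x, f x ∂eigenvalueMeasure (weightedPermMatrix (permOfCode m N) d) - I
      = (∑ k ∈ cycleRoots m N, (S N k - (cycleBlock m N k).card * I)) / N := by
    have hsum : (∑ k ∈ cycleRoots m N, ((cycleBlock m N k).card : ℝ)) = N := by
      exact_mod_cast sum_card_cycleBlock m N
    rw [integral_eigenvalueMeasure_weightedPermMatrix, Finset.sum_sub_distrib, ← Finset.sum_mul,
      hsum]
    field_simp
    rfl
  have hsplit : ∑ k ∈ cycleRoots m N, |S N k - (cycleBlock m N k).card * I| ≤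
      ∑ k ∈ Finset.range K, |S N k - (cycleBlock m N k).card * I| +
        C * (Finset.card {j ∈ Finset.range N | K ≤ cycleRoot m j} : ℕ) := by
    rw [← Finset.sum_filter_not_add_sum_filter (cycleRoots m N) (fun k => K ≤ k),
      ← sum_card_cycleBlock_of_le, Nat.cast_sum, Finset.mul_sum]
    refine add_le_add (Finset.sum_le_sum_of_subset_of_nonneg ?_ fun _ _ _ => abs_nonneg _)
      (Finset.sum_le_sum fun k _ => hbound k)
    intro k hk
    simpa using (Finset.mem_filter.1 hk).2
  rw [Real.dist_eq, hdiff, abs_div, abs_of_pos hNpos, div_lt_iff₀ hNpos]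
  rw [← Finset.sum_div, div_lt_iff₀ hNpos] at h2
  have h4 : C * ((Finset.card {j ∈ Finset.range N | K ≤ cycleRoot m j} : ℕ) : ℝ) ≤ ε / 2 * N := by
    calc _ ≤ C * (ε / (2 * (C + 1)) * N) := by gcongr
      _ = (C / (C + 1)) * (ε / 2 * N) := by field_simp
      _ ≤ 1 * (ε / 2 * N) := by
        gcongr
        rw [div_le_one (by positivity)]
        linarith
      _ = _ := one_mul _
  have h5 := Finset.abs_sum_le_sum_abs (fun k => S N k - (cycleBlock m N k).card * I)
    (cycleRoots m N)
  linarith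

/-! ### The code as a process with independent steps -/

/-- The law of the code `(m_j)` of a virtual permutation under the Ewens measure. -/
noncomputable def codeMeasure (θ : ℝ) (hθ : 0 < θ) : Measure (∀ j : ℕ, Fin (j + 1)) :=
  Measure.infinitePi fun j => (ewensCodeStep θ hθ j).toMeasure

instance instIsProbabilityMeasureCode (θ : ℝ) (hθ : 0 < θ) :
    IsProbabilityMeasure (codeMeasure θ hθ) :=
  inferInstanceAs (IsProbabilityMeasure
    (Measure.infinitePi fun j => (ewensCodeStep θ hθ j).toMeasure))

/-- The filtration generated by the code: at time `N`, the first `N` entries are known. -/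
def codeFiltration : Filtration ℕ (MeasurableSpace.pi : MeasurableSpace (∀ j : ℕ, Fin (j + 1))) where
  seq N := Filtration.piFinset (Finset.range N)
  mono' _ _ h := Filtration.piFinset.mono (Finset.range_subset_range.2 h)
  le' N := Filtration.piFinset.le (Finset.range N)

/-- Such a function factors through the first `N` entries, which live in a finite discrete space;
the value 0 is an irrelevant filler for the others. -/
theorem measurable_codeFiltration {α : Type*} [MeasurableSpace α] {N : ℕ}
    {g : (∀ j : ℕ, Fin (j + 1)) → α} (hg : ∀ m m', (∀ i < N, m i = m' i) → g m = g m') :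
    Measurable[codeFiltration N] g := by
  have h : g = (fun q : ∀ j : Finset.range N, Fin (j + 1) =>
      g fun i => if hi : i ∈ Finset.range N then q ⟨i, hi⟩ else 0) ∘ (Finset.range N).restrict := by
    funext m
    refine hg _ _ fun i hi => ?_
    simp [hi]
  rw [h]
  exact Measurable.comp (Measurable.of_discrete) (comap_measurable _)

theorem measurable_codeFiltration_cycleRoot {N j : ℕ} (h : j < N) :
    Measurable[codeFiltration N] fun m => cycleRoot m j :=
  measurable_codeFiltration fun _ _ hm => cycleRoot_congr fun i hi => hm i (hi.trans_lt h)

theorem measurable_cycleRoot (j : ℕ) : Measurable fun m => cycleRoot m j :=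
  (measurable_codeFiltration_cycleRoot j.lt_succ_self).mono (codeFiltration.le _) le_rfl

theorem codeMeasure_real_inter {θ : ℝ} (hθ : 0 < θ) {N : ℕ} {s : Set (∀ j : ℕ, Fin (j + 1))}
    (hs : MeasurableSet[codeFiltration N] s) (k : Fin (N + 1)) :
    (codeMeasure θ hθ).real (s ∩ {m | m N = k}) =
      (codeMeasure θ hθ).real s * ((if k = Fin.last N then θ else 1) / (θ + N)) := by
  obtain ⟨t, ht, rfl⟩ := hs
  have hind : iIndepFun (fun (i : ℕ) (m : ∀ j : ℕ, Fin (j + 1)) => m i) (codeMeasure θ hθ) :=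
    iIndepFun_infinitePi (X := fun i x => x) fun i => measurable_id
  have h2 := hind.indepFun_finset (Finset.range N) {N} (by simp) fun i => measurable_pi_apply i
  have h3 := h2.measure_inter_preimage_eq_mul _ {q | q ⟨N, by simp⟩ = k} ht
    MeasurableSet.of_discrete
  have h4 : codeMeasure θ hθ {m | m N = k} =
      ENNReal.ofReal ((if k = Fin.last N then θ else 1) / (θ + N)) := by
    have h5 := (measurePreserving_eval_infinitePi
      (fun j => (ewensCodeStep θ hθ j).toMeasure) N).measure_preimage
        (measurableSet_singleton k).nullMeasurableSet
    rw [PMF.toMeasure_apply_singleton _ _ (measurableSet_singleton k)] at h5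
    exact h5
  have h6 : 0 ≤ (if k = Fin.last N then θ else 1) / (θ + N) := by
    split_ifs <;> positivity
  change codeMeasure θ hθ (_ ∩ {m | m N = k}) = _ * codeMeasure θ hθ {m | m N = k} at h3
  rw [Measure.real, Measure.real, ← ENNReal.toReal_ofReal h6, ← h4, ← ENNReal.toReal_mul]
  exact congrArg ENNReal.toReal h3

/-! ### Early cycles carry almost all the mass -/

/-- The number of elements below `N` lying in one of the cycles which meet `{0, …, K - 1}`. -/
def numOld (K N : ℕ) (m : ∀ j : ℕ, Fin (j + 1)) : ℕ :=
  Finset.card {j ∈ Finset.range N | cycleRoot m j < K}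

theorem numOld_le (K N : ℕ) (m : ∀ j : ℕ, Fin (j + 1)) : numOld K N m ≤ N :=
  (Finset.card_filter_le _ _).trans (Finset.card_range N).le

theorem numOld_self (K : ℕ) (m : ∀ j : ℕ, Fin (j + 1)) : numOld K K m = K := by
  rw [numOld, Finset.filter_true_of_mem, Finset.card_range]
  exact fun j hj => (cycleRoot_le m j).trans_lt (Finset.mem_range.1 hj)

theorem numOld_eq_sum (K N : ℕ) (m : ∀ j : ℕ, Fin (j + 1)) : (numOld K N m : ℝ) =
    ∑ j ∈ Finset.range N, {m | cycleRoot m j < K}.indicator (fun _ => (1 : ℝ)) m := by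
  rw [numOld, Finset.card_filter, Nat.cast_sum]
  refine Finset.sum_congr rfl fun j _ => ?_
  simp [Set.indicator_apply]

theorem measurable_codeFiltration_numOld (K N : ℕ) :
    Measurable[codeFiltration N] (numOld K N) :=
  measurable_codeFiltration fun m m' h => by
    rw [numOld, numOld]
    congr 1
    refine Finset.filter_congr fun j hj => ?_
    rw [cycleRoot_congr fun i hi => h i (hi.trans_lt (Finset.mem_range.1 hj))]

theorem measurable_numOld (K N : ℕ) : Measurable (numOld K N) :=
  (measurable_codeFiltration_numOld K N).mono (codeFiltration.le _) le_rfl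

theorem measurableSet_cycleRoot_lt (K j : ℕ) :
    MeasurableSet {m : ∀ j : ℕ, Fin (j + 1) | cycleRoot m j < K} :=
  measurable_cycleRoot j (measurableSet_Iio (a := K))

section

variable {θ : ℝ} (hθ : 0 < θ)

theorem setIntegral_numOld (K N : ℕ) (s : Set (∀ j : ℕ, Fin (j + 1))) :
    ∫ m in s, (numOld K N m : ℝ) ∂codeMeasure θ hθ =
      ∑ j ∈ Finset.range N, (codeMeasure θ hθ).real (s ∩ {m | cycleRoot m j < K}) := by
  simp_rw [numOld_eq_sum]
  rw [integral_finsetSum _ fun j _ =>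
    (integrable_const (1 : ℝ)).indicator (measurableSet_cycleRoot_lt K j)]
  refine Finset.sum_congr rfl fun j _ => ?_
  rw [integral_indicator (measurableSet_cycleRoot_lt K j), setIntegral_const, smul_eq_mul, mul_one,
    measureReal_restrict_apply (measurableSet_cycleRoot_lt K j), Set.inter_comm]

theorem integrable_numOld_div (K N : ℕ) :
    Integrable (fun m => (numOld K N m : ℝ) / (θ + N)) (codeMeasure θ hθ) := by
  refine Integrable.div_const (Integrable.of_bound
    (measurable_from_top.comp (measurable_numOld K N)).aestronglyMeasurable N
      (ae_of_all _ fun m => ?_)) _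
  simpa using numOld_le K N m

/-- Given the past, `N` attaches to each earlier element with probability `1 / (θ + N)`, so it joins
an old cycle with conditional probability at least `numOld K N / (θ + N)`. Only an inequality holds
in general, as `N` may also open a cycle with `N < K`. -/
theorem setIntegral_numOld_div_le {K N : ℕ} {s : Set (∀ j : ℕ, Fin (j + 1))}
    (hs : MeasurableSet[codeFiltration N] s) :
    (∫ m in s, (numOld K N m : ℝ) ∂codeMeasure θ hθ) / (θ + N) ≤
      (codeMeasure θ hθ).real (s ∩ {m | cycleRoot m N < K}) := by
  rw [setIntegral_numOld, Finset.sum_div, ← Fin.sum_univ_eq_sum_range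
    (fun j => (codeMeasure θ hθ).real (s ∩ {m | cycleRoot m j < K}) / (θ + N))]
  have hmeas : ∀ j : Fin N, MeasurableSet[codeFiltration N]
      (s ∩ {m | cycleRoot m j < K}) := fun j =>
    hs.inter (measurable_codeFiltration_cycleRoot j.2 (measurableSet_Iio (a := K)))
  have h1 : ∀ j : Fin N, (codeMeasure θ hθ).real (s ∩ {m | cycleRoot m j < K}) / (θ + N) =
      (codeMeasure θ hθ).real (s ∩ {m | cycleRoot m j < K} ∩ {m | m N = j.castSucc}) := fun j => by
    rw [codeMeasure_real_inter hθ (hmeas j), if_neg (Fin.castSucc_ne_last j), one_div,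
      div_eq_mul_inv]
  have h2 : ∀ j : Fin N, MeasurableSet
      (s ∩ {m | cycleRoot m j < K} ∩ {m | m N = j.castSucc}) := fun j =>
    (codeFiltration.le N _ (hmeas j)).inter
      (measurableSet_eq_fun (measurable_pi_apply N) measurable_const)
  simp_rw [h1]
  rw [← measureReal_biUnion_finset (fun i _ j _ hij => ?_) fun j _ => h2 j]
  · refine measureReal_mono (Set.iUnion₂_subset fun j _ m hm => ⟨hm.1.1, ?_⟩)
    have hj : m N = j.castSucc := hm.2
    change cycleRoot m N < K
    rw [cycleRoot_of_ne_last (by rw [hj]; exact Fin.castSucc_ne_last j), hj]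
    exact hm.1.2
  · refine Set.disjoint_left.2 fun m hm hm' => hij (Fin.castSucc_injective N ?_)
    exact (show m N = i.castSucc from hm.2).symm.trans hm'.2

theorem submartingale_numOld_div (K : ℕ) :
    Submartingale (fun (N : ℕ) m => (numOld K N m : ℝ) / (θ + N)) codeFiltration
      (codeMeasure θ hθ) := by
  refine submartingale_of_setIntegral_le_succ (fun N => ?_) (integrable_numOld_div hθ K)
    fun N s hs => ?_
  · have h : Measurable[codeFiltration N] fun m => (numOld K N m : ℝ) / (θ + N) :=
      (measurable_from_top (f := fun n : ℕ => (n : ℝ) / (θ + N))).comp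
        (measurable_codeFiltration_numOld K N)
    exact h.stronglyMeasurable
  · have h1 := setIntegral_numOld_div_le hθ (K := K) hs
    have hpos : 0 < θ + N := by positivity
    rw [integral_div, integral_div, setIntegral_numOld (N := N + 1), Finset.sum_range_succ,
      ← setIntegral_numOld, div_le_div_iff₀ hpos (by positivity)]
    rw [div_le_iff₀ hpos] at h1
    push_cast
    linarith

/-- Bounded submartingale convergence. At time `K` every element is old, so the submartingale equals
`K / (θ + K)` there, and its mean cannot decrease afterwards. -/
theorem exists_tendsto_numOld_div (K : ℕ) : ∃ W : (∀ j : ℕ, Fin (j + 1)) → ℝ,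
    Measurable W ∧ (∀ᵐ m ∂codeMeasure θ hθ,
      Tendsto (fun N : ℕ => (numOld K N m : ℝ) / (θ + N)) atTop (𝓝 (W m)) ∧ 0 ≤ W m ∧ W m ≤ 1) ∧
    K / (θ + K) ≤ ∫ m, W m ∂codeMeasure θ hθ := by
  have hbd : ∀ (N : ℕ) m, 0 ≤ (numOld K N m : ℝ) / (θ + N) ∧ (numOld K N m : ℝ) / (θ + N) ≤ 1 := by
    intro N m
    refine ⟨by positivity, div_le_one_of_le₀ ?_ (by positivity)⟩
    have : (numOld K N m : ℝ) ≤ N := by exact_mod_cast numOld_le K N m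
    linarith
  have hnorm : ∀ (N : ℕ) m, ‖(numOld K N m : ℝ) / (θ + N)‖ ≤ 1 := fun N m => by
    rw [Real.norm_of_nonneg (hbd N m).1]
    exact (hbd N m).2
  have hsub := submartingale_numOld_div hθ K
  have hlim := hsub.ae_tendsto_limitProcess (R := 1) fun N => by
    refine (eLpNorm_le_of_ae_bound (C := 1) (ae_of_all _ (hnorm N))).trans ?_
    simp
  refine ⟨codeFiltration.limitProcess (fun (N : ℕ) m => (numOld K N m : ℝ) / (θ + N))
    (codeMeasure θ hθ), Filtration.stronglyMeasurable_limit_process'.measurable, ?_, ?_⟩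
  · filter_upwards [hlim] with m hm
    exact ⟨hm, ge_of_tendsto' hm fun N => (hbd N m).1, le_of_tendsto' hm fun N => (hbd N m).2⟩
  · have hint := tendsto_integral_of_dominated_convergence (fun _ => (1 : ℝ))
      (fun N => (integrable_numOld_div hθ K N).aestronglyMeasurable) (integrable_const _)
      (fun N => ae_of_all _ (hnorm N)) hlim
    refine ge_of_tendsto hint (eventually_atTop.2 ⟨K, fun N hN => ?_⟩)
    have h := hsub.setIntegral_le hN MeasurableSet.univ
    simp only [setIntegral_univ, numOld_self] at h
    simpa using h

/-- By Markov's inequality, `1 - W K ≥ ε` has probability at most `θ / (θ + K) / ε`; letting `K`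
grow, this almost surely fails for some `K`. -/
theorem ae_exists_numOld_gt {ε : ℝ} (hε : 0 < ε) : ∀ᵐ m ∂codeMeasure θ hθ, ∃ K : ℕ,
    ∀ᶠ N : ℕ in atTop, 1 - ε < (numOld K N m : ℝ) / (θ + N) := by
  choose W hWm hW hWint using exists_tendsto_numOld_div hθ
  have hnull : (codeMeasure θ hθ).real {m | ∀ K, ε ≤ 1 - W K m} = 0 := by
    refine le_antisymm ?_ measureReal_nonneg
    have hlim : Tendsto (fun K : ℕ => θ / (θ + K) / ε) atTop (𝓝 0) := by
      have h : Tendsto (fun K : ℕ => θ / (θ + K)) atTop (𝓝 0) :=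
        tendsto_const_nhds.div_atTop (tendsto_atTop_add_const_left _ _ tendsto_natCast_atTop_atTop)
      simpa using h.div_const ε
    refine ge_of_tendsto' hlim fun K => ?_
    rw [le_div_iff₀ hε, mul_comm]
    have hWi : Integrable (W K) (codeMeasure θ hθ) :=
      Integrable.of_bound (hWm K).aestronglyMeasurable 1 (by
        filter_upwards [hW K] with m hm
        rw [Real.norm_of_nonneg hm.2.1]
        exact hm.2.2)
    have h := mul_meas_ge_le_integral_of_nonneg (μ := codeMeasure θ hθ) (f := fun m => 1 - W K m)
      (by filter_upwards [hW K] with m hm using sub_nonneg.2 hm.2.2)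
      ((integrable_const 1).sub hWi) ε
    rw [integral_sub (integrable_const 1) hWi] at h
    have hmono : (codeMeasure θ hθ).real {m | ∀ K, ε ≤ 1 - W K m} ≤
        (codeMeasure θ hθ).real {m | ε ≤ 1 - W K m} := measureReal_mono fun m hm => hm K
    have hK : θ / (θ + K) = 1 - K / (θ + K) := by
      have : θ + K ≠ 0 := by positivity
      field_simp
      ring
    have h2 := hWint K
    simp only [integral_const, probReal_univ, smul_eq_mul, mul_one] at h
    calc _ ≤ ε * (codeMeasure θ hθ).real {m | ε ≤ 1 - W K m} := by gcongr
      _ ≤ _ := h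
      _ ≤ _ := by linarith
  rw [measureReal_eq_zero_iff] at hnull
  have hae : ∀ᵐ m ∂codeMeasure θ hθ, ¬ ∀ K, ε ≤ 1 - W K m := measure_eq_zero_iff_ae_notMem.1 hnull
  filter_upwards [hae, ae_all_iff.2 hW] with m hm hWm
  push Not at hm
  obtain ⟨K, hK⟩ := hm
  exact ⟨K, (hWm K).1.eventually_const_lt (by linarith)⟩

/-- Under the Ewens measure, the cycles opened early asymptotically fill everything. -/
theorem ae_forall_exists_card_le : ∀ᵐ m ∂codeMeasure θ hθ, ∀ ε > (0 : ℝ), ∃ K : ℕ,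
    ∀ᶠ N : ℕ in atTop,
      ((Finset.card {j ∈ Finset.range N | K ≤ cycleRoot m j} : ℕ) : ℝ) ≤ ε * N := by
  have h : ∀ᵐ m ∂codeMeasure θ hθ, ∀ n : ℕ, ∃ K : ℕ, ∀ᶠ N : ℕ in atTop,
      1 - 1 / ((n : ℝ) + 1) < (numOld K N m : ℝ) / (θ + N) :=
    ae_all_iff.2 fun n => ae_exists_numOld_gt hθ Nat.one_div_pos_of_nat
  filter_upwards [h] with m hm ε hε
  obtain ⟨n, hn⟩ := exists_nat_one_div_lt hε
  obtain ⟨K, hK⟩ := hm n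
  refine ⟨K, hK.mono fun N hN => ?_⟩
  have hcard : numOld K N m + Finset.card {j ∈ Finset.range N | K ≤ cycleRoot m j} = N := by
    have h := Finset.card_filter_add_card_filter_not (s := Finset.range N)
      (fun j => cycleRoot m j < K)
    simp only [not_lt, Finset.card_range] at h
    exact h
  have hcard' : (numOld K N m : ℝ) +
      ((Finset.card {j ∈ Finset.range N | K ≤ cycleRoot m j} : ℕ) : ℝ) = N := by
    exact_mod_cast hcard
  have hpos : 0 < θ + N := by positivity
  rw [lt_div_iff₀ hpos] at hN
  -- This term is what allows the normalization `θ + N` to be replaced by `N`.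
  have h1 : 0 ≤ (1 - 1 / ((n : ℝ) + 1)) * θ :=
    mul_nonneg (sub_nonneg.2 (div_le_one_of_le₀ (by simp) (by positivity))) hθ.le
  have h2 : 1 / ((n : ℝ) + 1) * N ≤ ε * N := by gcongr
  linarith

end

/-! ### Law of large numbers along a cycle -/

theorem sum_range_filter_eq_sum_nth (p : ℕ → Prop) [DecidablePred p] (g : ℕ → ℝ) (N : ℕ) :
    ∑ j ∈ Finset.range N with p j, g j = ∑ i ∈ Finset.range (Nat.count p N), g (Nat.nth p i) := by
  induction N with
  | zero => simp
  | succ N ih =>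
    rw [Finset.range_add_one, Finset.filter_insert, Nat.count_succ]
    split_ifs with h
    · rw [Finset.sum_insert (by simp), ih, Finset.sum_range_succ, Nat.nth_count h, add_comm]
    · rw [ih, add_zero]

/-- The strong law of large numbers along a set of indices. -/
theorem ae_tendsto_average_filter (L : Measure ℂˣ) [IsProbabilityMeasure L] {g : ℂˣ → ℝ}
    (hgm : Measurable g) (hg : Integrable g L) (p : ℕ → Prop) [DecidablePred p] :
    ∀ᵐ z ∂Measure.infinitePi fun _ : ℕ => L,
      Tendsto (fun N => Finset.card {j ∈ Finset.range N | p j}) atTop atTop →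
        Tendsto (fun N => (∑ j ∈ Finset.range N with p j, g (z j)) /
          ((Finset.card {j ∈ Finset.range N | p j} : ℕ) : ℝ)) atTop (𝓝 (∫ x, g x ∂L)) := by
  -- If infinite, the index set is enumerated injectively by `Nat.nth`, which keeps the variables
  -- i.i.d.; if finite, the cardinality cannot diverge.
  by_cases hp : (Set.ofPred p).Infinite
  · have hmp : ∀ i, MeasurePreserving (Function.eval i) (Measure.infinitePi fun _ : ℕ => L) L :=
      fun i => measurePreserving_eval_infinitePi (fun _ : ℕ => L) i
    have hind : iIndepFun (fun (i : ℕ) (z : ℕ → ℂˣ) => g (z i))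
        (Measure.infinitePi fun _ : ℕ => L) := iIndepFun_infinitePi (X := fun _ => g) fun _ => hgm
    have hident : ∀ i j, IdentDistrib (fun z : ℕ → ℂˣ => g (z i)) (fun z => g (z j))
        (Measure.infinitePi fun _ : ℕ => L) (Measure.infinitePi fun _ : ℕ => L) := fun i j =>
      IdentDistrib.comp (u := g) ⟨(hmp i).aemeasurable, (hmp j).aemeasurable,
        (hmp i).map_eq.trans (hmp j).map_eq.symm⟩ hgm
    have h := strong_law_ae_real (fun i (z : ℕ → ℂˣ) => g (z (Nat.nth p i)))
      ((hmp _).integrable_comp_of_integrable hg)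
      (fun i j hij => hind.indepFun ((Nat.nth_injective hp).ne hij)) fun i => hident _ _
    have hmean : ∫ z, g (z (Nat.nth p 0)) ∂(Measure.infinitePi fun _ : ℕ => L) = ∫ x, g x ∂L := by
      conv_rhs => rw [← (hmp (Nat.nth p 0)).map_eq]
      rw [integral_map (hmp _).aemeasurable hgm.aestronglyMeasurable]
    filter_upwards [h] with z hz htop
    rw [hmean] at hz
    refine (hz.comp htop).congr fun N => ?_
    rw [sum_range_filter_eq_sum_nth p (fun j => g (z j)), Nat.count_eq_card_filter_range]
    rfl
  · refine ae_of_all _ fun z htop => absurd htop fun htop => ?_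
    have hfin := Set.not_infinite.1 hp
    obtain ⟨N, hN⟩ := (htop.eventually_gt_atTop hfin.toFinset.card).exists
    exact hN.not_ge (Finset.card_le_card fun j hj => hfin.mem_toFinset.2 (Finset.mem_filter.1 hj).2)

/-! ### Measurability and transfer to the law of the matrices -/

theorem measurable_log_norm_units : Measurable fun z : ℂˣ => Real.log ‖(z : ℂ)‖ :=
  Real.measurable_log.comp (measurable_norm.comp (comap_measurable _))

instance instStandardBorelSpaceComplexUnits : StandardBorelSpace ℂˣ := by
  have : PolishSpace ℂˣ := Units.isClosedEmbedding_embedProduct.polishSpace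
  have : BorelSpace ℂˣ := ⟨by
    rw [Units.isEmbedding_val₀.eq_induced, borel_comap, ← BorelSpace.measurable_eq]
    rfl⟩
  infer_instance

/-- The sequence of matrices as a function of the code and of the weights. -/
noncomputable def matrixSeqOfCode (p : (∀ j : ℕ, Fin (j + 1)) × (ℕ → ℂˣ)) (N : ℕ+) :
    Matrix (Fin N) (Fin N) ℂ :=
  matrixSeq (virtualPermOfCode p.1, p.2) N

theorem matrixSeqOfCode_apply (p : (∀ j : ℕ, Fin (j + 1)) × (ℕ → ℂˣ)) (N : ℕ+) :
    matrixSeqOfCode p N = weightedPermMatrix (permOfCode p.1 N) fun j => (p.2 j : ℂ) := rfl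

/-- The positions of the nonzero entries give the permutations, their values give the weights; `m N`
is the image of the last element at level `N + 1`. -/
theorem matrixSeqOfCode_injective : Function.Injective matrixSeqOfCode := by
  rintro ⟨m, z⟩ ⟨m', z'⟩ h
  have hent : ∀ (N : ℕ) (k : Fin (N + 1)), permOfCode m (N + 1) k = permOfCode m' (N + 1) k ∧
      z (permOfCode m (N + 1) k) = z' (permOfCode m (N + 1) k) := by
    intro N k
    have h1 := congrFun (congrFun (congrFun h N.succPNat) (permOfCode m (N + 1) k)) k
    simp only [matrixSeqOfCode_apply] at h1
    change (if permOfCode m (N + 1) k = permOfCode m (N + 1) k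
      then (z (permOfCode m (N + 1) k) : ℂ) else 0) =
      (if permOfCode m (N + 1) k = permOfCode m' (N + 1) k
        then (z' (permOfCode m (N + 1) k) : ℂ) else 0) at h1
    rw [if_pos rfl] at h1
    split_ifs at h1 with h2
    · exact ⟨h2, Units.ext h1⟩
    · exact absurd h1 (Units.ne_zero _)
  refine Prod.ext (funext fun N => ?_) (funext fun N => ?_)
  · have h1 := (hent N (Fin.last N)).1
    rwa [permOfCode_succ_last, permOfCode_succ_last] at h1
  · have h1 := (hent N ((permOfCode m (N + 1)).symm (Fin.last N))).2
    rwa [Equiv.apply_symm_apply] at h1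

theorem measurable_matrixSeqOfCode : Measurable matrixSeqOfCode :=
  measurable_matrixSeq.comp (measurable_virtualPermOfCode.prodMap measurable_id)

/-- Lusin–Souslin. An embedding transports almost sure statements to the image law without
measurability of the convergence event. -/
theorem measurableEmbedding_matrixSeqOfCode : MeasurableEmbedding matrixSeqOfCode := by
  have : MeasurableSpace.CountablySeparated (∀ N : ℕ+, Matrix (Fin N) (Fin N) ℂ) :=
    inferInstanceAs (MeasurableSpace.CountablySeparated (∀ N : ℕ+, Fin N → Fin N → ℂ))
  exact measurable_matrixSeqOfCode.measurableEmbedding matrixSeqOfCode_injective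

theorem matrixLaw_eq_map (θ : ℝ) (hθ : 0 < θ) (L : Measure ℂˣ) [IsProbabilityMeasure L] :
    matrixLaw θ hθ L =
      ((codeMeasure θ hθ).prod (Measure.infinitePi fun _ : ℕ => L)).map matrixSeqOfCode := by
  have h := Measure.map_prod_map (codeMeasure θ hθ) (Measure.infinitePi fun _ : ℕ => L)
    measurable_virtualPermOfCode measurable_id
  rw [Measure.map_id] at h
  rw [matrixLaw, show ewensMeasure θ hθ = (codeMeasure θ hθ).map virtualPermOfCode from rfl, h,
    Measure.map_map measurable_matrixSeq (measurable_virtualPermOfCode.prodMap measurable_id)]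
  rfl

theorem measurable_sum_cycleBlock (N k : ℕ) {g : ℂˣ → ℝ} (hg : Measurable g) :
    Measurable fun p : (∀ j : ℕ, Fin (j + 1)) × (ℕ → ℂˣ) =>
      ∑ j ∈ cycleBlock p.1 N k, g (p.2 j) := by
  simp_rw [cycleBlock, Finset.sum_filter]
  refine Finset.measurable_sum _ fun j _ => Measurable.ite ?_ ?_ measurable_const
  · exact ((measurable_cycleRoot j).comp measurable_fst) (measurableSet_singleton k)
  · exact hg.comp ((measurable_pi_apply j).comp measurable_snd)

theorem measurable_card_cycleBlock (N k : ℕ) :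
    Measurable fun m : ∀ j : ℕ, Fin (j + 1) => (cycleBlock m N k).card := by
  simp_rw [cycleBlock, Finset.card_filter]
  exact Finset.measurable_sum _ fun j _ => Measurable.ite
    (measurable_cycleRoot j (measurableSet_singleton k)) measurable_const measurable_const

/-- By Fubini the code may be frozen, so that the cycle becomes a deterministic index set
independent of the weights. -/
theorem ae_tendsto_average_cycleBlock (θ : ℝ) (hθ : 0 < θ) (L : Measure ℂˣ)
    [IsProbabilityMeasure L] {g : ℂˣ → ℝ} (hgm : Measurable g) (hg : Integrable g L) (k : ℕ) :
    ∀ᵐ p ∂(codeMeasure θ hθ).prod (Measure.infinitePi fun _ : ℕ => L),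
      Tendsto (fun N => (cycleBlock p.1 N k).card) atTop atTop →
        Tendsto (fun N => (∑ j ∈ cycleBlock p.1 N k, g (p.2 j)) / (cycleBlock p.1 N k).card) atTop
          (𝓝 (∫ x, g x ∂L)) := by
  have h1 : MeasurableSet {p : (∀ j : ℕ, Fin (j + 1)) × (ℕ → ℂˣ) |
      Tendsto (fun N => (cycleBlock p.1 N k).card) atTop atTop} :=
    measurableSet_tendsto atTop fun N => (measurable_card_cycleBlock N k).comp measurable_fst
  have h2 : MeasurableSet {p : (∀ j : ℕ, Fin (j + 1)) × (ℕ → ℂˣ) |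
      Tendsto (fun N => (∑ j ∈ cycleBlock p.1 N k, g (p.2 j)) / ((cycleBlock p.1 N k).card : ℝ))
        atTop (𝓝 (∫ x, g x ∂L))} :=
    measurableSet_tendsto _ fun N => (measurable_sum_cycleBlock N k hgm).div
      (measurable_from_top.comp ((measurable_card_cycleBlock N k).comp measurable_fst))
  rw [Measure.ae_prod_iff_ae_ae (h1.imp h2)]
  exact ae_of_all _ fun m => ae_tendsto_average_filter L hgm hg fun j => cycleRoot m j = k

theorem integral_spectralDistribution {N : ℕ} [NeZero N] (M : Matrix (Fin N) (Fin N) ℂ)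
    (f : ℂ → ℝ) : ∫ x, f x ∂(spectralDistribution M : Measure ℂ) =
      (N : ℝ)⁻¹ * ∫ x, f x ∂eigenvalueMeasure M := by
  change ∫ x, f x ∂((N : ENNReal)⁻¹ • eigenvalueMeasure M) = _
  rw [integral_smul_measure, ENNReal.toReal_inv, ENNReal.toReal_natCast, smul_eq_mul]

end EwensMatrix

theorem proposition3p1 {Ω : Type*} [MeasurableSpace Ω] (P : Measure Ω) [IsProbabilityMeasure P]
    (θ : ℝ) (hθ : 0 < θ) (L : Measure ℂˣ) [IsProbabilityMeasure L]
    (hL : Integrable (fun z : ℂˣ => Real.log ‖(z : ℂ)‖) L)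
    (M : (N : ℕ+) → Ω → Matrix (Fin N) (Fin N) ℂ)
    (hM : HasLaw (fun ω N => M N ω) (EwensMatrix.matrixLaw θ hθ L) P) :
    ∀ᵐ ω ∂P, Tendsto (fun N : ℕ+ => EwensMatrix.spectralDistribution (M N ω)) atTop
      (𝓝 (EwensMatrix.uniformCircle (Real.exp (∫ z : ℂˣ, Real.log ‖(z : ℂ)‖ ∂L)))) := by
  have key : ∀ᵐ A ∂P.map (fun ω N => M N ω),
      Tendsto (fun N : ℕ+ => EwensMatrix.spectralDistribution (A N)) atTop
        (𝓝 (EwensMatrix.uniformCircle (Real.exp (∫ z : ℂˣ, Real.log ‖(z : ℂ)‖ ∂L)))) := by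
    rw [hM.map_eq, EwensMatrix.matrixLaw_eq_map,
      EwensMatrix.measurableEmbedding_matrixSeqOfCode.ae_map_iff]
    filter_upwards [Measure.quasiMeasurePreserving_fst.ae (EwensMatrix.ae_forall_exists_card_le hθ),
      ae_all_iff.2 (EwensMatrix.ae_tendsto_average_cycleBlock θ hθ L
        EwensMatrix.measurable_log_norm_units hL)] with p htight hlog
    -- Bounded Lipschitz functions suffice for weak convergence; `C` bounds the oscillation of `f`.
    rw [tendsto_iff_forall_lipschitz_integral_tendsto]
    rintro f ⟨C, hC⟩ ⟨K, hf⟩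
    have h := EwensMatrix.tendsto_average_eigenvalues (d := fun j => (p.2 j : ℂ))
      (fun j => (p.2 j).ne_zero) htight hlog hC hf
    refine (h.comp tendsto_PNat_val_atTop_atTop).congr fun N => ?_
    rw [EwensMatrix.integral_spectralDistribution]
    rfl
  exact ae_of_ae_map hM.aemeasurable key
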